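/- All rings are commutative with identity and $\otimes$ means $\otimes_C$, with $A^{\otimes 0}=C$. Let $C$ be a ring, $A$ a $C$-algebra and $\lambda\in C$. The shuffle Baxter algebra of weight $\lambda$ on $A$ is the $C$-module $\mathrm{Sh}_C(A)=\bigoplus_{k\ge 0}A^{\otimes(k+1)}$ with the following multiplication and operator. For $m,n\ge 0$, an $(m,n)$-mixable shuffle is a pair $(\sigma,T)$ where $\sigma$ is a permutation of $\{1,\dots,m+n\}$ with $\sigma^{-1}(1)<\dots<\sigma^{-1}(m)$ and $\sigma^{-1}(m+1)<\dots<\sigma^{-1}(m+n)$, and $T$ is a set of pairs $(k,k+1)$ with $1\le k<m+n$ and $\sigma(k)\le m<\sigma(k+1)$. For $x=x_0\otimes x_1\otimes\dots\otimes x_m$ and $y=y_0\otimes y_1\otimes\dots\otimes y_n$ put $(u_1,\dots,u_{m+n})=(x_1,\dots,x_m,y_1,\dots,y_n)$, and let $\sigma(x^+\otimes y^+;T)\in A^{\otimes(m+n-|T|)}$ be obtained from $u_{\sigma(1)}\otimes\dots\otimes u_{\sigma(m+n)}$ by replacing, for each $(k,k+1)\in T$, the symbol $\otimes$ between $u_{\sigma(k)}$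 and $u_{\sigma(k+1)}$ by the product of $A$. The multiplication of $\mathrm{Sh}_C(A)$ is the $C$-bilinear map with $$x\cdot y=\sum_{(\sigma,T)}\lambda^{|T|}\,x_0y_0\otimes\sigma(x^+\otimes y^+;T),$$ the sum being over all $(m,n)$-mixable shuffles, and the Baxter operator is the $C$-linear map $P_A$ with $P_A(x_0\otimes\dots\otimes x_m)=1\otimes x_0\otimes\dots\otimes x_m$. A Baxter ideal of $\mathrm{Sh}_C(A)$ is an ideal $I$ with $P_A(I)\subseteq I$. A partially ordered set satisfies the ascending chain condition if each of its ascending chains $a_0\le a_1\le a_2\le\cdots$ becomes stationary; sets of ideals and of submodules are ordered by inclusion. **Theorem.** Let $A$ be a $C$-algebra. 1. Let $\mathcal M$ be the partially ordered set of those $A$-submodules of $A\otimes A$ (with $A$ acting on the left factor) that are the image of the natural map $A\otimes M\to A\otimes A$ for some $C$-submodule $M$ of $A$. If $\mathcal M$ does not satisfy the ascending chain condition, then the set of Baxter ideals of $\mathrm{Sh}_C(A)$ of weight zero does not satisfy the ascending chain condition. 2. If $A$ is not a noetherian ring, then for every $\lambda\in C$ the set of Baxter ideals of $\mathrm{Sh}_C(A)$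 of weight $\lambda$ does not satisfy the ascending chain condition. -/

import Mathlib

open scoped TensorProduct DirectSum

noncomputable section

namespace ShuffleBaxter

/-! ### Mixable shuffles -/

/-- `σ` is an `(m,n)`-shuffle: with positions and letters numbered from `0`,
`σ⁻¹(0) < ⋯ < σ⁻¹(m-1)` and `σ⁻¹(m) < ⋯ < σ⁻¹(m+n-1)`. -/
def IsShuffle {m n : ℕ} (σ : Equiv.Perm (Fin (m + n))) : Prop :=
  (∀ i j : Fin m, i < j → σ.symm (Fin.castAdd n i) < σ.symm (Fin.castAdd n j)) ∧
  (∀ i j : Fin n, i < j → σ.symm (Fin.natAdd m i) < σ.symm (Fin.natAdd m j))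

/-- The pair of neighbouring positions `(k, k+1)` is admissible for `σ`: the letter in position
`k` is one of the first `m` letters, the letter in position `k+1` is one of the last `n`. -/
def IsAdmissible {m n : ℕ} (σ : Equiv.Perm (Fin (m + n))) (k : Fin (m + n)) : Prop :=
  ∃ h : k.val + 1 < m + n, (σ k).val < m ∧ m ≤ (σ ⟨k.val + 1, h⟩).val

open Classical in
/-- The set `S̄(m,n)` of mixable `(m,n)`-shuffles `(σ, T)`. A pair `(k, k+1)` in `T` is recorded by
its left member `k`. -/
def mixableShuffles (m n : ℕ) : Finset (Equiv.Perm (Fin (m + n)) × Finset (Fin (m + n))) :=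
  Finset.univ.filter fun p => IsShuffle p.1 ∧ ∀ k ∈ p.2, IsAdmissible p.1 k

theorem mem_mixableShuffles {m n : ℕ}
    {p : Equiv.Perm (Fin (m + n)) × Finset (Fin (m + n))} :
    p ∈ mixableShuffles m n ↔ IsShuffle p.1 ∧ ∀ k ∈ p.2, IsAdmissible p.1 k := by
  classical
  simp [mixableShuffles]

/-- When the letters in positions `k` and `k+1` are merged for every `k ∈ T`, the letter in
position `k` becomes part of the factor number `blockIndex T k` (counted from `0`), which is the
number of positions `j < k` that are not merged with their right neighbour. -/
def blockIndex {N : ℕ} (T : Finset (Fin N)) (k : Fin N) : ℕ :=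
  (Finset.univ.filter fun j : Fin N => j < k ∧ j ∉ T).card

/-- The factors of the mixable shuffle `u_{σ(1)} ⊗̂ ⋯ ⊗̂ u_{σ(N)}`, where `⊗̂` between the positions
`k` and `k+1` is the product of `A` if `k ∈ T`, and `⊗` otherwise; there are `N - |T|` of them. -/
def mixWord {A : Type*} [CommRing A] {N : ℕ} (σ : Equiv.Perm (Fin N)) (T : Finset (Fin N))
    (u : Fin N → A) : Fin (N - T.card) → A :=
  fun i => ∏ k ∈ Finset.univ.filter (fun k : Fin N => blockIndex T k = i.val), u (σ k)

/-- The factors of the pure tensor `x₀y₀ ⊗ σ(x⁺ ⊗ y⁺; T)`, for `x = x₀ ⊗ x⁺`, `y = y₀ ⊗ y⁺`. -/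
def mixFactors {A : Type*} [CommRing A] {m n : ℕ} (σ : Equiv.Perm (Fin (m + n)))
    (T : Finset (Fin (m + n))) (x : Fin (m + 1) → A) (y : Fin (n + 1) → A) :
    Fin (m + n - T.card + 1) → A :=
  Fin.cons (x 0 * y 0) (mixWord σ T (Fin.append (Fin.tail x) (Fin.tail y)))

/-! Multilinearity of the mixable shuffles -/

theorem blockIndex_lt {m n : ℕ} {σ : Equiv.Perm (Fin (m + n))} {T : Finset (Fin (m + n))}
    (hT : ∀ k ∈ T, IsAdmissible σ k) (k : Fin (m + n)) : blockIndex T k < m + n - T.card := by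
  classical
  have hc : (Finset.univ.filter fun j : Fin (m + n) => j ∉ T).card = m + n - T.card := by
    have : (Finset.univ.filter fun j : Fin (m + n) => j ∉ T) = Tᶜ := by ext; simp
    rw [this, Finset.card_compl, Fintype.card_fin]
  rw [← hc]
  refine Finset.card_lt_card ((Finset.ssubset_iff_of_subset ?_).2 ?_)
  · intro j hj
    simp only [Finset.mem_filter, Finset.mem_univ, true_and] at hj ⊢
    exact hj.2
  · by_cases hk : k ∈ T
    · obtain ⟨h, -, h2⟩ := hT k hk
      refine ⟨⟨k.val + 1, h⟩, ?_, ?_⟩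
      · simp only [Finset.mem_filter, Finset.mem_univ, true_and]
        intro hk'
        obtain ⟨_, h3, _⟩ := hT _ hk'
        omega
      · simp only [Finset.mem_filter, Finset.mem_univ, true_and, not_and]
        intro h'
        rw [Fin.lt_def] at h'
        simp at h'
    · exact ⟨k, by simp [hk], by simp⟩

theorem mixWord_update {A : Type*} [CommRing A] {m n : ℕ} {σ : Equiv.Perm (Fin (m + n))}
    {T : Finset (Fin (m + n))} (hT : ∀ k ∈ T, IsAdmissible σ k) (u : Fin (m + n) → A)
    (j : Fin (m + n)) :
    ∃ (i : Fin (m + n - T.card)) (c : A), ∀ a : A,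
      mixWord σ T (Function.update u j a) = Function.update (mixWord σ T u) i (a * c) := by
  classical
  refine ⟨⟨blockIndex T (σ.symm j), blockIndex_lt hT _⟩,
    ∏ k ∈ (Finset.univ.filter fun k : Fin (m + n) =>
      blockIndex T k = blockIndex T (σ.symm j)).erase (σ.symm j), u (σ k), fun a => ?_⟩
  funext i
  by_cases hi : i = ⟨blockIndex T (σ.symm j), blockIndex_lt hT _⟩
  · subst hi
    rw [Function.update_self]
    unfold mixWord
    rw [← Finset.mul_prod_erase _ _ (show σ.symm j ∈ Finset.univ.filter
      (fun k : Fin (m + n) => blockIndex T k = blockIndex T (σ.symm j)) by simp)]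
    congr 1
    · simp
    · refine Finset.prod_congr rfl fun k hk => ?_
      rw [Function.update_of_ne]
      rintro rfl
      simp at hk
  · rw [Function.update_of_ne hi]
    refine Finset.prod_congr rfl fun k hk => ?_
    rw [Function.update_of_ne]
    rintro rfl
    apply hi
    ext
    simpa using (Finset.mem_filter.1 hk).2.symm

theorem mixFactors_update_left {A : Type*} [CommRing A] {m n : ℕ}
    {σ : Equiv.Perm (Fin (m + n))} {T : Finset (Fin (m + n))}
    (hT : ∀ k ∈ T, IsAdmissible σ k) (x : Fin (m + 1) → A) (y : Fin (n + 1) → A)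
    (j : Fin (m + 1)) :
    ∃ (i : Fin (m + n - T.card + 1)) (c : A), ∀ a : A,
      mixFactors σ T (Function.update x j a) y =
        Function.update (mixFactors σ T x y) i (a * c) := by
  refine Fin.cases ?_ (fun j => ?_) j
  · refine ⟨0, y 0, fun a => ?_⟩
    simp [mixFactors, Fin.update_cons_zero]
  · obtain ⟨i, c, h⟩ := mixWord_update hT (Fin.append (Fin.tail x) (Fin.tail y))
      (Fin.castAdd n j)
    refine ⟨i.succ, c, fun a => ?_⟩
    have e : Fin.append (Function.update (Fin.tail x) j a) (Fin.tail y) =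
        Function.update (Fin.append (Fin.tail x) (Fin.tail y)) (Fin.castAdd n j) a := by
      funext k
      refine Fin.addCases (fun k => ?_) (fun k => ?_) k
      · simp [Function.update_apply]
      · rw [Fin.append_right, Function.update_of_ne, Fin.append_right]
        intro h
        have := congrArg Fin.val h
        simp at this
        omega
    simp only [mixFactors, Fin.tail_update_succ, e, h, Fin.cons_update]
    simp [Function.update_of_ne (Fin.succ_ne_zero j).symm]

theorem mixFactors_update_right {A : Type*} [CommRing A] {m n : ℕ}
    {σ : Equiv.Perm (Fin (m + n))} {T : Finset (Fin (m + n))}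
    (hT : ∀ k ∈ T, IsAdmissible σ k) (x : Fin (m + 1) → A) (y : Fin (n + 1) → A)
    (j : Fin (n + 1)) :
    ∃ (i : Fin (m + n - T.card + 1)) (c : A), ∀ a : A,
      mixFactors σ T x (Function.update y j a) =
        Function.update (mixFactors σ T x y) i (a * c) := by
  refine Fin.cases ?_ (fun j => ?_) j
  · refine ⟨0, x 0, fun a => ?_⟩
    simp [mixFactors, Fin.update_cons_zero, mul_comm]
  · obtain ⟨i, c, h⟩ := mixWord_update hT (Fin.append (Fin.tail x) (Fin.tail y))
      (Fin.natAdd m j)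
    refine ⟨i.succ, c, fun a => ?_⟩
    have e : Fin.append (Fin.tail x) (Function.update (Fin.tail y) j a) =
        Function.update (Fin.append (Fin.tail x) (Fin.tail y)) (Fin.natAdd m j) a := by
      funext k
      refine Fin.addCases (fun k => ?_) (fun k => ?_) k
      · rw [Fin.append_left, Function.update_of_ne, Fin.append_left]
        intro h
        have := congrArg Fin.val h
        simp at this
        omega
      · simp [Function.update_apply]
    simp only [mixFactors, Fin.tail_update_succ, e, h, Fin.cons_update]
    simp [Function.update_of_ne (Fin.succ_ne_zero j).symm]

/-! ### The shuffle Baxter algebra -/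

/-- The underlying `C`-module `⨁_{k ≥ 0} A^{⊗(k+1)}` of the shuffle Baxter algebra `Ш_C(A)` of weight
`wt`; tensor powers are taken over `C`. The weight enters through the multiplication. -/
def Sha (C A : Type*) [CommRing C] [CommRing A] [Algebra C A] (_wt : C) : Type _ :=
  ⨁ k : ℕ, ⨂[C]^(k + 1) A

section

variable {C A : Type*} [CommRing C] [CommRing A] [Algebra C A] {wt : C}

instance : AddCommGroup (Sha C A wt) :=
  inferInstanceAs (AddCommGroup (⨁ k : ℕ, ⨂[C]^(k + 1) A))

instance : Module C (Sha C A wt) :=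
  inferInstanceAs (Module C (⨁ k : ℕ, ⨂[C]^(k + 1) A))

end

/-- The inclusion of the summand `A^{⊗(k+1)}` in `Ш_C(A)`. -/
def Sha.ofDeg {C A : Type*} [CommRing C] [CommRing A] [Algebra C A] (wt : C) (k : ℕ) :
    (⨂[C]^(k + 1) A) →ₗ[C] Sha C A wt :=
  DirectSum.lof C ℕ (fun k => ⨂[C]^(k + 1) A) k

/-- The pure tensor `x₀ ⊗ x₁ ⊗ ⋯ ⊗ xₖ` as an element of `Ш_C(A)`. -/
def Sha.pure {C A : Type*} [CommRing C] [CommRing A] [Algebra C A] (wt : C) {k : ℕ}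
    (x : Fin (k + 1) → A) : Sha C A wt :=
  Sha.ofDeg wt k (PiTensorProduct.tprod C x)

/-- The term of index `(σ, T)` of the mixed shuffle product, `wt^{|T|} x₀y₀ ⊗ σ(x⁺ ⊗ y⁺; T)`, as a
multilinear function of `x₀, …, x_m` and of `y₀, …, y_n`. -/
def mixTerm {C A : Type*} [CommRing C] [CommRing A] [Algebra C A] (wt : C) {m n : ℕ}
    (p : Equiv.Perm (Fin (m + n)) × Finset (Fin (m + n))) (hp : p ∈ mixableShuffles m n) :
    MultilinearMap C (fun _ : Fin (m + 1) => A)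
      (MultilinearMap C (fun _ : Fin (n + 1) => A) (Sha C A wt)) :=
  have hT : ∀ k ∈ p.2, IsAdmissible p.1 k := (mem_mixableShuffles.1 hp).2
  MultilinearMap.mk'
    (fun x => MultilinearMap.mk'
      (fun y => wt ^ p.2.card • Sha.pure wt (mixFactors p.1 p.2 x y))
      (fun y j a b => by
        obtain ⟨i, c, h⟩ := mixFactors_update_right hT x y j
        simp only [h, Sha.pure, add_mul, MultilinearMap.map_update_add, map_add, smul_add])
      (fun y j r a => by
        obtain ⟨i, c, h⟩ := mixFactors_update_right hT x y j
        simp only [h, Sha.pure, smul_mul_assoc, MultilinearMap.map_update_smul, map_smul]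
        rw [smul_comm]))
    (fun x j a b => by
      ext y
      obtain ⟨i, c, h⟩ := mixFactors_update_left hT x y j
      simp only [MultilinearMap.mk'_apply, add_apply, h, Sha.pure, add_mul,
        MultilinearMap.map_update_add, map_add, smul_add])
    (fun x j r a => by
      ext y
      obtain ⟨i, c, h⟩ := mixFactors_update_left hT x y j
      simp only [MultilinearMap.mk'_apply, smul_apply, h, Sha.pure,
        smul_mul_assoc, MultilinearMap.map_update_smul, map_smul]
      rw [smul_comm])

/-- The mixed shuffle product `A^{⊗(m+1)} × A^{⊗(n+1)} → Ш_C(A)`. -/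
def mixMulDeg {C A : Type*} [CommRing C] [CommRing A] [Algebra C A] (wt : C) (m n : ℕ) :
    (⨂[C]^(m + 1) A) →ₗ[C] (⨂[C]^(n + 1) A) →ₗ[C] Sha C A wt :=
  PiTensorProduct.lift
    ((PiTensorProduct.lift (R := C) (s := fun _ : Fin (n + 1) => A)
        (E := Sha C A wt)).toLinearMap.compMultilinearMap
      (∑ p ∈ (mixableShuffles m n).attach, mixTerm wt p.1 p.2))

/-- The mixed shuffle product on `Ш_C(A)`, extended bilinearly to the direct sum. -/
def mixMul {C A : Type*} [CommRing C] [CommRing A] [Algebra C A] (wt : C) :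
    Sha C A wt →ₗ[C] Sha C A wt →ₗ[C] Sha C A wt :=
  DirectSum.toModule C ℕ (Sha C A wt →ₗ[C] Sha C A wt) fun m =>
    LinearMap.flip (DirectSum.toModule C ℕ ((⨂[C]^(m + 1) A) →ₗ[C] Sha C A wt) fun n =>
      LinearMap.flip (mixMulDeg wt m n))

section

variable {C A : Type*} [CommRing C] [CommRing A] [Algebra C A] {wt : C}

/-- `Ш_C(A)` with the mixed shuffle product. Additive structure and multiplication are all that the
notion of an ideal refers to, so the remaining ring axioms are not recorded here. -/
instance : NonUnitalNonAssocRing (Sha C A wt) :=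
  { (inferInstance : AddCommGroup (Sha C A wt)) with
    mul := fun x y => mixMul wt x y
    left_distrib := fun x y z => map_add (mixMul wt x) y z
    right_distrib := fun x y z => LinearMap.map_add₂ (mixMul wt) x y z
    zero_mul := fun x => LinearMap.map_zero₂ (mixMul wt) x
    mul_zero := fun x => map_zero (mixMul wt x) }

end

/-- The mixed shuffle product of two pure tensors. -/
theorem Sha.pure_mul_pure {C A : Type*} [CommRing C] [CommRing A] [Algebra C A] (wt : C) {m n : ℕ}
    (x : Fin (m + 1) → A) (y : Fin (n + 1) → A) :
    Sha.pure wt x * Sha.pure wt y =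
      ∑ p ∈ mixableShuffles m n, wt ^ p.2.card • Sha.pure wt (mixFactors p.1 p.2 x y) := by
  change mixMul wt (Sha.pure wt x) (Sha.pure wt y) = _
  unfold mixMul Sha.pure Sha.ofDeg
  erw [DirectSum.toModule_lof, LinearMap.flip_apply, DirectSum.toModule_lof]
  rw [LinearMap.flip_apply, mixMulDeg, PiTensorProduct.lift.tprod,
    LinearMap.compMultilinearMap_apply, LinearEquiv.coe_coe, PiTensorProduct.lift.tprod,
    sum_apply, sum_apply, ← Finset.sum_attach (mixableShuffles m n)]
  rfl

/-- The Baxter operator `P_A(x₀ ⊗ ⋯ ⊗ xₖ) = 1 ⊗ x₀ ⊗ ⋯ ⊗ xₖ` of `Ш_C(A)`. -/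
def Sha.baxterOp {C A : Type*} [CommRing C] [CommRing A] [Algebra C A] (wt : C) :
    Sha C A wt →ₗ[C] Sha C A wt :=
  DirectSum.toModule C ℕ (Sha C A wt) fun k =>
    (Sha.ofDeg wt (k + 1)).comp (PiTensorProduct.lift
      ((PiTensorProduct.tprod C : MultilinearMap C (fun _ : Fin (k + 2) => A) _).curryLeft 1))

/-- The Baxter operator on pure tensors. -/
theorem Sha.baxterOp_pure {C A : Type*} [CommRing C] [CommRing A] [Algebra C A] (wt : C) {k : ℕ}
    (x : Fin (k + 1) → A) :
    Sha.baxterOp wt (Sha.pure wt x) = Sha.pure wt (Fin.cons 1 x : Fin (k + 2) → A) := by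
  unfold Sha.baxterOp Sha.pure Sha.ofDeg
  erw [DirectSum.toModule_lof]
  change DirectSum.lof C ℕ (fun k => ⨂[C]^(k + 1) A) (k + 1) (PiTensorProduct.lift _ _) = _
  rw [PiTensorProduct.lift.tprod]
  rfl

/-! ### Baxter ideals -/

/-- A Baxter ideal of `(R, P)`: an ideal `I` of `R` with `P(I) ⊆ I`. An ideal is an additive
subgroup that absorbs multiplication by elements of `R` (on both sides, which is no restriction when
`R` is commutative). -/
def IsBaxterIdeal {R : Type*} [NonUnitalNonAssocRing R] (P : R → R) (I : TwoSidedIdeal R) : Prop :=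
  ∀ x ∈ I, P x ∈ I

/-- The partially ordered set of Baxter ideals of `Ш_C(A)` of weight `wt`, ordered by inclusion. -/
abbrev BaxterIdeals (C A : Type*) [CommRing C] [CommRing A] [Algebra C A] (wt : C) : Type _ :=
  {I : TwoSidedIdeal (Sha C A wt) // IsBaxterIdeal (Sha.baxterOp wt) I}

/-- The `A`-submodule of `A ⊗ A` (with `A` acting on the left factor) which is the image of
`A ⊗ M → A ⊗ A`, for a `C`-submodule `M` of `A`. -/
def tensorImage {C A : Type*} [CommRing C] [CommRing A] [Algebra C A] (M : Submodule C A) :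
    Submodule A (A ⊗[C] A) :=
  LinearMap.range (M.subtype.baseChange A)

/-- The partially ordered set of the `A`-submodules of `A ⊗ A` of the form "image of `A ⊗ M`",
ordered by inclusion. -/
abbrev TensorImages (C A : Type*) [CommRing C] [CommRing A] [Algebra C A] : Type _ :=
  {N : Submodule A (A ⊗[C] A) // ∃ M : Submodule C A, N = tensorImage M}

end ShuffleBaxter

end

/-- The ascending chain condition for a partially ordered set: every ascending chain
`a₀ ≤ a₁ ≤ a₂ ≤ ⋯` becomes stationary. -/
def AscendingChainCondition (α : Type*) [PartialOrder α] : Prop :=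
  ∀ a : ℕ → α, Monotone a → ∃ n, ∀ m, n ≤ m → a n = a m

open ShuffleBaxter

/-! Both parts embed a poset into the Baxter ideals by an injective monotone map and pull the chain
condition back. Write π₀ and π₁ for the projections of `Sha` onto `A` and `A ⊗ A`. A term `(σ, T)`
of a product of degrees `m` and `n` has degree `m + n - |T|`, which is at least `max m n` because
`|T| ≤ min m n`. So π₀ is multiplicative for every weight, and it kills the image of the Baxter
operator: π₀⁻¹(I) is a Baxter ideal for every ideal `I` of `A`. In weight zero only `T = ∅`
survives, so the product is graded and π₁(xy) = π₀(x)π₁(y) + π₀(y)π₁(x), while π₁(P x) = 1 ⊗ π₀(x).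
Hence {π₀ = 0, π₁ ∈ N} is a Baxter ideal for every `A`-submodule `N` of `A ⊗ A`. In weight λ, two
factors of degree one also contribute λ x₀y₀ ⊗ x₁y₁ to `A ⊗ A`, which breaks the derivation rule. -/

/-- The ascending chain condition passes down along an injective monotone map. -/
theorem AscendingChainCondition.of_injective_monotone {α β : Type*} [PartialOrder α]
    [PartialOrder β] {f : α → β} (hf : Function.Injective f) (hm : Monotone f)
    (h : AscendingChainCondition β) : AscendingChainCondition α := fun a ha => by
  obtain ⟨n, hn⟩ := h (f ∘ a) (hm.comp ha)
  exact ⟨n, fun m hnm => hf (hn m hnm)⟩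

theorem isNoetherianRing_of_ascendingChainCondition {A : Type*} [CommRing A]
    (h : AscendingChainCondition (Ideal A)) : IsNoetherianRing A :=
  monotone_stabilizes_iff_noetherian.1 fun f => h f f.monotone

namespace ShuffleBaxter

/-! ### Degrees and low-degree cases of mixable shuffles -/

/-- An admissible set of pairs injects into the letters of either word. -/
theorem card_le_of_isAdmissible {m n : ℕ} {σ : Equiv.Perm (Fin (m + n))}
    {T : Finset (Fin (m + n))} (hT : ∀ k ∈ T, IsAdmissible σ k) : T.card ≤ m ∧ T.card ≤ n := by
  constructor
  · have h : T.image (Fin.val ∘ σ) ⊆ Finset.range m := by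
      intro i hi
      obtain ⟨k, hk, rfl⟩ := Finset.mem_image.1 hi
      obtain ⟨-, h1, -⟩ := hT k hk
      exact Finset.mem_range.2 h1
    have := Finset.card_le_card h
    rwa [Finset.card_range, Finset.card_image_of_injective _
      (Fin.val_injective.comp σ.injective)] at this
  -- The second-word letter of a merged pair sits at `k + 1`, so `T` shifted by one lies in the
  -- positions of second-word letters; `σ` injects these into an interval of length `n`.
  · have h : (T.image fun k => k.val + 1) ⊆
        (Finset.univ.filter fun k : Fin (m + n) => m ≤ (σ k).val).image Fin.val := by
      intro i hi
      obtain ⟨k, hk, rfl⟩ := Finset.mem_image.1 hi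
      obtain ⟨h0, -, h2⟩ := hT k hk
      exact Finset.mem_image.2 ⟨⟨k.val + 1, h0⟩, by simpa using h2, rfl⟩
    have h' : (Finset.univ.filter fun k : Fin (m + n) => m ≤ (σ k).val).image
        (Fin.val ∘ σ) ⊆ Finset.Ico m (m + n) := by
      intro i hi
      obtain ⟨k, hk, rfl⟩ := Finset.mem_image.1 hi
      exact Finset.mem_Ico.2 ⟨(Finset.mem_filter.1 hk).2, (σ k).isLt⟩
    have h1 := Finset.card_le_card h
    have h2 := Finset.card_le_card h'
    rw [Finset.card_image_of_injective _ (fun a b hab => by simpa [Fin.ext_iff] using hab),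
      Finset.card_image_of_injective _ Fin.val_injective] at h1
    rw [Nat.card_Ico, Finset.card_image_of_injective _
      (Fin.val_injective.comp σ.injective)] at h2
    omega

/-- If one of the two words is empty and the other has at most one letter, the only mixable shuffle
is the trivial one. -/
theorem mixableShuffles_eq_singleton {m n : ℕ} (h : m + n ≤ 1) :
    mixableShuffles m n = {(1, ∅)} := by
  have : Subsingleton (Fin (m + n)) := Fin.subsingleton_iff_le_one.2 h
  ext ⟨σ, T⟩
  rw [mem_mixableShuffles, Finset.mem_singleton]
  constructor
  · rintro ⟨-, hT⟩
    refine Prod.ext (Subsingleton.elim _ _) (Finset.eq_empty_of_forall_notMem fun k hk => ?_)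
    obtain ⟨h0, -⟩ := hT k hk
    omega
  · intro h'
    obtain ⟨rfl, rfl⟩ := Prod.ext_iff.1 h'
    refine ⟨⟨fun i j hij => ?_, fun i j hij => ?_⟩, by simp⟩ <;>
    · rw [Fin.lt_def] at hij
      omega

theorem mixFactors_zero {A : Type*} [CommRing A] {m n : ℕ} (σ : Equiv.Perm (Fin (m + n)))
    (T : Finset (Fin (m + n))) (x : Fin (m + 1) → A) (y : Fin (n + 1) → A) :
    mixFactors σ T x y 0 = x 0 * y 0 := rfl

/-- The index `i` is the only one there is; leaving it free lets it be presented as coming from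
either word. -/
theorem mixFactors_one_empty_last {A : Type*} [CommRing A] {m n : ℕ} (h : m + n = 1)
    (v : Fin (m + 1) → A)
    (w : Fin (n + 1) → A) (i : Fin (m + n)) :
    mixFactors 1 ∅ v w (Fin.last _) = Fin.append (Fin.tail v) (Fin.tail w) i := by
  have e : (Fin.last (m + n - (∅ : Finset (Fin (m + n))).card)) =
      Fin.succ ⟨0, by simp; omega⟩ := by
    ext
    simp [h]
  have : Subsingleton (Fin (m + n)) := Fin.subsingleton_iff_le_one.2 h.le
  have : Unique (Fin (m + n)) := ⟨⟨i⟩, fun j => Subsingleton.elim _ _⟩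
  rw [e, mixFactors, Fin.cons_succ, mixWord, Finset.filter_true_of_mem]
  · simp [Subsingleton.elim default i]
  · intro k _
    -- There is only one block, so every block index is `0`.
    have := blockIndex_lt (σ := 1) (T := ∅) (by simp) k
    simp at this
    simp
    omega

/-! ### Projections onto `A` and `A ⊗ A` -/

variable {C A : Type*} [CommRing C] [CommRing A] [Algebra C A] {wt : C}

namespace Sha

/-- Induction on sums of scalar multiples of pure tensors. -/
theorem induction_on {p : Sha C A wt → Prop} (x : Sha C A wt) (zero : p 0)
    (smul_pure : ∀ (r : C) (k : ℕ) (v : Fin (k + 1) → A), p (r • pure wt v))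
    (add : ∀ x y, p x → p y → p (x + y)) : p x := by
  refine DirectSum.induction_on (motive := p) x zero (fun k t => ?_) add
  change p (ofDeg wt k t)
  induction t using PiTensorProduct.induction_on with
  | smul_tprod r v =>
    rw [map_smul]
    exact smul_pure r k v
  | add a b ha hb =>
    rw [map_add]
    exact add _ _ ha hb

/-- Bilinear identities in the shuffle Baxter algebra can be checked on pure tensors. -/
theorem bilinear_ext {M : Type*} [AddCommGroup M] [Module C M]
    {f g : Sha C A wt →ₗ[C] Sha C A wt →ₗ[C] M}
    (h : ∀ (m n : ℕ) (v : Fin (m + 1) → A) (w : Fin (n + 1) → A),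
      f (pure wt v) (pure wt w) = g (pure wt v) (pure wt w)) : f = g := by
  ext x y
  induction x using induction_on with
  | zero => simp
  | add x x' hx hx' => simp [hx, hx']
  | smul_pure r m v =>
    induction y using induction_on with
    | zero => simp
    | add y y' hy hy' => simp only [map_add, hy, hy']
    | smul_pure s n w => simp [h]

/-- The projection of `Ш_C(A)` onto the summand `A`. -/
noncomputable def projZero (wt : C) : Sha C A wt →ₗ[C] A :=
  (PiTensorProduct.lift (MultilinearMap.mkPiAlgebra C (Fin 1) A)).comp
    (DirectSum.component C ℕ (fun k => ⨂[C]^(k + 1) A) 0)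

/-- The projection of `Ш_C(A)` onto the summand `A ⊗ A`. -/
noncomputable def projOne (wt : C) : Sha C A wt →ₗ[C] A ⊗[C] A :=
  (PiTensorProduct.lift ((MultilinearMap.mkPiAlgebra C (Fin 2) (A ⊗[C] A)).compLinearMap
    ![(Algebra.TensorProduct.includeLeft (R := C) (S := C)).toLinearMap,
      (Algebra.TensorProduct.includeRight (R := C)).toLinearMap])).comp
    (DirectSum.component C ℕ (fun k => ⨂[C]^(k + 1) A) 1)

theorem component_pure_of_ne {k l : ℕ} (h : k ≠ l) (v : Fin (k + 1) → A) :
    DirectSum.component C ℕ (fun k => ⨂[C]^(k + 1) A) l (pure wt v) = 0 :=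
  DirectSum.of_eq_of_ne _ _ _ h.symm

theorem component_pure_self {k : ℕ} (v : Fin (k + 1) → A) :
    DirectSum.component C ℕ (fun k => ⨂[C]^(k + 1) A) k (pure wt v) =
      PiTensorProduct.tprod C v :=
  DirectSum.component.lof_self _ _ _

/-- The degree is a variable with an equation because in products it has the form `m + n - T.card`.
-/
theorem projZero_pure {k : ℕ} (h : k = 0) (v : Fin (k + 1) → A) :
    projZero wt (pure wt v) = v 0 := by
  subst h
  erw [projZero, LinearMap.comp_apply, component_pure_self, PiTensorProduct.lift.tprod]
  simp

theorem projZero_pure_of_ne {k : ℕ} (h : k ≠ 0) (v : Fin (k + 1) → A) :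
    projZero wt (pure wt v) = 0 := by
  erw [projZero, LinearMap.comp_apply, component_pure_of_ne h, map_zero]

theorem projOne_pure {k : ℕ} (h : k = 1) (v : Fin (k + 1) → A) :
    projOne wt (pure wt v) = v 0 ⊗ₜ v (Fin.last k) := by
  subst h
  erw [projOne, LinearMap.comp_apply, component_pure_self, PiTensorProduct.lift.tprod]
  simp [Fin.prod_univ_two]

theorem projOne_pure_of_ne {k : ℕ} (h : k ≠ 1) (v : Fin (k + 1) → A) :
    projOne wt (pure wt v) = 0 := by
  erw [projOne, LinearMap.comp_apply, component_pure_of_ne h, map_zero]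

theorem projZero_pure_mul_pure {m n : ℕ} (v : Fin (m + 1) → A) (w : Fin (n + 1) → A) :
    projZero wt (pure wt v * pure wt w) =
      projZero wt (pure wt v) * projZero wt (pure wt w) := by
  rw [pure_mul_pure, map_sum]
  by_cases h : m + n = 0
  · rw [mixableShuffles_eq_singleton (by omega), Finset.sum_singleton, map_smul,
      projZero_pure (by simpa using h), projZero_pure (by omega), projZero_pure (by omega)]
    rw [mixFactors_zero, Finset.card_empty, pow_zero, one_smul]
  · rw [Finset.sum_eq_zero]
    · rcases Nat.eq_zero_or_pos m with hm | hm
      · rw [projZero_pure_of_ne (k := n) (by omega), mul_zero]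
      · rw [projZero_pure_of_ne (k := m) (by omega), zero_mul]
    · intro p hp
      -- The degree of each term is at least `max m n`, hence positive here.
      have := card_le_of_isAdmissible (mem_mixableShuffles.1 hp).2
      rw [map_smul, projZero_pure_of_ne (by omega), smul_zero]

theorem projZero_mul (x y : Sha C A wt) :
    projZero wt (x * y) = projZero wt x * projZero wt y := by
  have h : (mixMul wt).compr₂ (projZero wt) =
      (LinearMap.mul C A).compl₁₂ (projZero wt) (projZero wt) :=
    bilinear_ext fun m n v w => projZero_pure_mul_pure v w
  exact LinearMap.congr_fun₂ h x y

/-- Degree one arises only from degrees `(0, 1)` and `(1, 0)`, where the trivial shuffle is the only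
one. -/
theorem projOne_pure_mul_pure {m n : ℕ} (v : Fin (m + 1) → A) (w : Fin (n + 1) → A) :
    projOne (0 : C) (pure 0 v * pure 0 w) =
      projZero (0 : C) (pure 0 v) • projOne (0 : C) (pure 0 w) +
        projZero (0 : C) (pure 0 w) • projOne (0 : C) (pure 0 v) := by
  rw [pure_mul_pure, map_sum]
  by_cases h : m + n = 1
  · rw [mixableShuffles_eq_singleton h.le, Finset.sum_singleton, map_smul,
      projOne_pure (by simpa using h)]
    rcases Nat.eq_zero_or_pos m with rfl | hm
    · obtain rfl : n = 1 := by omega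
      rw [projZero_pure rfl, projOne_pure rfl, projZero_pure_of_ne one_ne_zero, zero_smul,
        mixFactors_one_empty_last h v w (Fin.natAdd 0 0), Fin.append_right]
      simp [mixFactors_zero, TensorProduct.smul_tmul', Fin.tail]
    · obtain rfl : m = 1 := by omega
      obtain rfl : n = 0 := by omega
      rw [projZero_pure_of_ne one_ne_zero, projZero_pure rfl, projOne_pure rfl, zero_smul,
        mixFactors_one_empty_last h v w (Fin.castAdd 0 0), Fin.append_left]
      simp [mixFactors_zero, TensorProduct.smul_tmul', Fin.tail, mul_comm]
  · rw [Finset.sum_eq_zero]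
    · rcases Nat.eq_zero_or_pos m with hm | hm
      · rw [projOne_pure_of_ne (k := n) (by omega), projOne_pure_of_ne (k := m) (by omega)]
        simp
      · rw [projZero_pure_of_ne (k := m) (by omega), zero_smul]
        rcases Nat.eq_zero_or_pos n with hn | hn
        · rw [projOne_pure_of_ne (k := m) (by omega)]
          simp
        · rw [projZero_pure_of_ne (k := n) (by omega)]
          simp
    · intro p _
      rw [map_smul]
      -- Without merging the degree is `m + n ≠ 1`; with merging the power of the weight is zero.
      by_cases hp : p.2.card = 0
      · rw [projOne_pure_of_ne (by omega), smul_zero]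
      · rw [zero_pow hp, zero_smul]

/-- In weight zero, the projection to `A ⊗ A` is a derivation along the projection to `A`. -/
theorem projOne_mul (x y : Sha C A (0 : C)) :
    projOne 0 (x * y) = projZero 0 x • projOne 0 y + projZero 0 y • projOne 0 x := by
  -- The action on the left factor as a `C`-bilinear map, so that the identity can be tested on pure
  -- tensors.
  let b : A →ₗ[C] A ⊗[C] A →ₗ[C] A ⊗[C] A := (Algebra.lsmul C C (A ⊗[C] A)).toLinearMap
  have h : (mixMul (0 : C)).compr₂ (projOne (A := A) 0) =
      b.compl₁₂ (projZero 0) (projOne 0) + (b.compl₁₂ (projZero 0) (projOne 0)).flip :=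
    bilinear_ext fun m n v w => projOne_pure_mul_pure v w
  exact LinearMap.congr_fun₂ h x y

theorem projZero_baxterOp (x : Sha C A wt) : projZero wt (baxterOp wt x) = 0 := by
  induction x using induction_on with
  | zero => simp
  | add x y hx hy => rw [map_add, map_add, hx, hy, add_zero]
  | smul_pure r k v =>
    rw [map_smul, map_smul, baxterOp_pure, projZero_pure_of_ne (Nat.succ_ne_zero k), smul_zero]

theorem projOne_baxterOp (x : Sha C A wt) :
    projOne wt (baxterOp wt x) = (1 : A) ⊗ₜ[C] projZero wt x := by
  induction x using induction_on with
  | zero => simp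
  | add x y hx hy => rw [map_add, map_add, hx, hy, map_add, TensorProduct.tmul_add]
  | smul_pure r k v =>
    rw [map_smul, map_smul, baxterOp_pure, map_smul, TensorProduct.tmul_smul]
    congr 1
    by_cases h : k = 0
    · subst h
      rw [projOne_pure rfl, projZero_pure rfl]
      rfl
    · rw [projOne_pure_of_ne (by omega), projZero_pure_of_ne h, TensorProduct.tmul_zero]

theorem projZero_surjective : Function.Surjective (projZero (A := A) wt) := fun a =>
  ⟨pure wt (k := 0) fun _ => a, projZero_pure rfl _⟩

/-- Allows a submodule `N` of `A ⊗ A` to be recovered from its Baxter ideal, all of whose elements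
have `projZero` zero. -/
theorem exists_projZero_eq_zero_projOne_eq (t : A ⊗[C] A) :
    ∃ x : Sha C A wt, projZero wt x = 0 ∧ projOne wt x = t := by
  induction t with
  | zero => exact ⟨0, map_zero _, map_zero _⟩
  | tmul a b =>
    exact ⟨pure wt (k := 1) ![a, b], projZero_pure_of_ne one_ne_zero _, projOne_pure rfl _⟩
  | add s t hs ht =>
    obtain ⟨x, hx, rfl⟩ := hs
    obtain ⟨y, hy, rfl⟩ := ht
    exact ⟨x + y, by rw [map_add, hx, hy, add_zero], map_add _ _ _⟩

end Sha

/-! ### Order embeddings into the Baxter ideals -/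

/-- The Baxter ideal `I ⊕ ⨁_{k ≥ 1} A^{⊗(k+1)}` for an ideal `I` of `A`. -/
noncomputable def baxterIdealOfIdeal (wt : C) (I : Ideal A) : BaxterIdeals C A wt :=
  ⟨TwoSidedIdeal.mk' {x | Sha.projZero wt x ∈ I}
    (by simp)
    (fun hx hy => by
      rw [Set.mem_ofPred_eq, map_add]
      exact I.add_mem hx hy)
    (fun hx => by
      rw [Set.mem_ofPred_eq, map_neg]
      exact I.neg_mem hx)
    (fun hy => by
      rw [Set.mem_ofPred_eq, Sha.projZero_mul]
      exact I.mul_mem_left _ hy)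
    (fun hx => by
      rw [Set.mem_ofPred_eq, Sha.projZero_mul]
      exact I.mul_mem_right _ hx),
    fun x _ => by
      rw [TwoSidedIdeal.mem_mk', Set.mem_ofPred_eq, Sha.projZero_baxterOp]
      exact I.zero_mem⟩

theorem mem_baxterIdealOfIdeal {I : Ideal A} {x : Sha C A wt} :
    x ∈ (baxterIdealOfIdeal wt I).1 ↔ Sha.projZero wt x ∈ I := by
  rw [baxterIdealOfIdeal, TwoSidedIdeal.mem_mk', Set.mem_ofPred_eq]

theorem baxterIdealOfIdeal_le_iff {I J : Ideal A} :
    baxterIdealOfIdeal wt I ≤ baxterIdealOfIdeal wt J ↔ I ≤ J := by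
  constructor
  · intro h a ha
    obtain ⟨x, rfl⟩ := Sha.projZero_surjective (wt := wt) a
    exact mem_baxterIdealOfIdeal.1 (h (mem_baxterIdealOfIdeal.2 ha))
  · intro h x hx
    exact mem_baxterIdealOfIdeal.2 (h (mem_baxterIdealOfIdeal.1 hx))

/-- The weight zero Baxter ideal `0 ⊕ N ⊕ ⨁_{k ≥ 2} A^{⊗(k+1)}` for an `A`-submodule `N` of
`A ⊗ A`. -/
noncomputable def baxterIdealOfSubmodule (N : Submodule A (A ⊗[C] A)) : BaxterIdeals C A (0 : C) :=
  ⟨TwoSidedIdeal.mk' {x | Sha.projZero 0 x = 0 ∧ Sha.projOne 0 x ∈ N}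
    (by simp)
    (fun hx hy => by
      rw [Set.mem_ofPred_eq, map_add, map_add, hx.1, hy.1, add_zero]
      exact ⟨rfl, N.add_mem hx.2 hy.2⟩)
    (fun hx => by
      rw [Set.mem_ofPred_eq, map_neg, map_neg, hx.1, neg_zero]
      exact ⟨rfl, N.neg_mem hx.2⟩)
    -- The uncontrolled `projOne` of the arbitrary factor is multiplied by `projZero` of the ideal
    -- element, which is zero.
    (fun hy => by
      rw [Set.mem_ofPred_eq, Sha.projZero_mul, Sha.projOne_mul, hy.1, mul_zero, zero_smul, add_zero]
      exact ⟨rfl, N.smul_mem _ hy.2⟩)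
    (fun hx => by
      rw [Set.mem_ofPred_eq, Sha.projZero_mul, Sha.projOne_mul, hx.1, zero_mul, zero_smul, zero_add]
      exact ⟨rfl, N.smul_mem _ hx.2⟩),
    fun x hx => by
      rw [TwoSidedIdeal.mem_mk', Set.mem_ofPred_eq] at hx ⊢
      -- The operator raises degree by one, so an element without degree-zero part is sent into
      -- degrees at least two.
      rw [Sha.projZero_baxterOp, Sha.projOne_baxterOp, hx.1, TensorProduct.tmul_zero]
      exact ⟨rfl, N.zero_mem⟩⟩

theorem mem_baxterIdealOfSubmodule {N : Submodule A (A ⊗[C] A)} {x : Sha C A (0 : C)} :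
    x ∈ (baxterIdealOfSubmodule N).1 ↔ Sha.projZero 0 x = 0 ∧ Sha.projOne 0 x ∈ N := by
  rw [baxterIdealOfSubmodule, TwoSidedIdeal.mem_mk', Set.mem_ofPred_eq]

theorem baxterIdealOfSubmodule_le_iff {N N' : Submodule A (A ⊗[C] A)} :
    baxterIdealOfSubmodule N ≤ baxterIdealOfSubmodule N' ↔ N ≤ N' := by
  constructor
  · intro h t ht
    obtain ⟨x, hx, rfl⟩ := Sha.exists_projZero_eq_zero_projOne_eq (wt := (0 : C)) t
    exact (mem_baxterIdealOfSubmodule.1 (h (mem_baxterIdealOfSubmodule.2 ⟨hx, ht⟩))).2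
  · intro h x hx
    rw [mem_baxterIdealOfSubmodule] at hx ⊢
    exact ⟨hx.1, h hx.2⟩

end ShuffleBaxter

theorem theorem4p5 {C : Type*} {A : Type*} [CommRing C] [CommRing A] [Algebra C A] :
    (¬ AscendingChainCondition (ShuffleBaxter.TensorImages C A) →
      ¬ AscendingChainCondition (ShuffleBaxter.BaxterIdeals C A (0 : C))) ∧
    (¬ IsNoetherianRing A →
      ∀ wt : C, ¬ AscendingChainCondition (ShuffleBaxter.BaxterIdeals C A wt)) := by
  refine ⟨mt fun h => ?_, fun hA wt => mt (fun h => ?_) hA⟩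
  · refine h.of_injective_monotone (f := fun N => baxterIdealOfSubmodule N.1) ?_
      fun _ _ => baxterIdealOfSubmodule_le_iff.2
    -- Reflecting the order gives injectivity by antisymmetry.
    exact fun N N' e => le_antisymm (baxterIdealOfSubmodule_le_iff.1 e.le)
      (baxterIdealOfSubmodule_le_iff.1 e.ge)
  · refine isNoetherianRing_of_ascendingChainCondition <|
      h.of_injective_monotone (f := baxterIdealOfIdeal wt) ?_
      fun _ _ => baxterIdealOfIdeal_le_iff.2
    exact fun I J e => le_antisymm (baxterIdealOfIdeal_le_iff.1 e.le)
      (baxterIdealOfIdeal_le_iff.1 e.ge)
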